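/- Let $H$ be Hall's universal locally finite group, i.e. the group, unique up to isomorphism, such that: $H$ is countable; $H$ is locally finite (every finitely generated subgroup is finite); every finite group embeds into $H$; and any two isomorphic finite subgroups of $H$ are conjugate in $H$. Then for every countable locally finite group $G$ there are a subgroup $G' \leq H$ with $G' \cong G$ and an assignment $f \mapsto \hat{f}$, sending each $f \in \mathrm{Aut}(G')$ to an automorphism $\hat{f} \in \mathrm{Aut}(H)$ that extends $f$ (that is, $\hat{f}(x) = f(x)$ for all $x \in G'$), such that $f \mapsto \hat{f}$ is an injective group homomorphism from $\mathrm{Aut}(G')$ to $\mathrm{Aut}(H)$. -/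

import Mathlib

/-- A group is locally finite if each of its finitely generated subgroups is finite. -/
def IsLocallyFiniteGroup (G : Type*) [Group G] : Prop :=
  ∀ K : Subgroup G, K.FG → Finite K

/-- The characterizing properties of Hall's universal locally finite group. -/
structure IsHallUniversalGroup (H : Type*) [Group H] : Prop where
  countable : Countable H
  locallyFinite : IsLocallyFiniteGroup H
  /-- `H` embeds every finite group (every finite group has a copy in the lowest universe). -/
  embeds_finite : ∀ (K : Type) [Group K] [Finite K],
    ∃ f : K →* H, Function.Injective f
  /-- Any two isomorphic finite subgroups are conjugate in `H`. -/
  conj_of_iso : ∀ A B : Subgroup H, Finite A → Finite B → Nonempty (A ≃* B) →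
    ∃ h : H, A.map (MulAut.conj h).toMonoidHom = B

/-! Hall's group is the union of a tower in which each stage makes isomorphic finite subgroups of
the previous one conjugate. The point is to build the tower without arbitrary choices, so that
automorphisms extend functorially. In a locally finite `G`, an isomorphism of finite subgroups is
induced by permutations of `G` that conjugate left translations, but no such permutation is
canonical. So all choices are used at once: `ConjugatorExtension G` consists of families of
permutations indexed by every `ConjugatorChoice G`, and an automorphism of `G` also permutes the
index set. The conjugators preserve the cosets of a finite subgroup, which keeps the extension
locally finite (`ConjugatorExtension.isLocallyFiniteGroup`). Starting the tower from `G × H`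
supplies all finite groups, so its limit is a Hall group, isomorphic to `H` by back-and-forth
(`IsHallUniversalGroup.nonempty_mulEquiv`). Automorphisms of `G` act on `G × H`, then on the limit,
then on `H`. -/

theorem isLocallyFiniteGroup_iff {G : Type*} [Group G] :
    IsLocallyFiniteGroup G ↔ ∀ s : Set G, s.Finite → Finite (Subgroup.closure s) := by
  constructor
  · intro h s hs
    exact h _ ((Subgroup.fg_iff _).2 ⟨s, rfl, hs⟩)
  · intro h K hK
    obtain ⟨s, rfl, hs⟩ := (Subgroup.fg_iff _).1 hK
    exact h s hs

theorem IsLocallyFiniteGroup.prod {G H : Type*} [Group G] [Group H]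
    (hG : IsLocallyFiniteGroup G) (hH : IsLocallyFiniteGroup H) :
    IsLocallyFiniteGroup (G × H) := by
  rw [isLocallyFiniteGroup_iff] at *
  intro s hs
  have := hG _ (hs.image Prod.fst)
  have := hH _ (hs.image Prod.snd)
  have hle : Subgroup.closure s ≤
      (Subgroup.closure (Prod.fst '' s)).prod (Subgroup.closure (Prod.snd '' s)) := by
    rw [Subgroup.closure_le]
    intro x hx
    exact ⟨Subgroup.subset_closure ⟨x, hx, rfl⟩, Subgroup.subset_closure ⟨x, hx, rfl⟩⟩
  have : Finite ((Subgroup.closure (Prod.fst '' s)).prod (Subgroup.closure (Prod.snd '' s))) :=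
    Finite.of_equiv _ (Subgroup.prodEquiv _ _).symm.toEquiv
  exact Finite.of_injective _ (Subgroup.inclusion_injective hle)

theorem IsLocallyFiniteGroup.finite_sup {G : Type*} [Group G] (hG : IsLocallyFiniteGroup G)
    (A B : Subgroup G) [Finite A] [Finite B] : Finite (A ⊔ B : Subgroup G) := by
  have := isLocallyFiniteGroup_iff.1 hG ((A : Set G) ∪ B) ((Set.toFinite _).union (Set.toFinite _))
  rwa [Subgroup.closure_union, Subgroup.closure_eq, Subgroup.closure_eq] at this

/-- A finitely generated group is finite if its homomorphisms to a fixed finite group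
separate points. -/
theorem finite_of_separating_homs {K M : Type*} [Group K] [Group.FG K] [Group M] [Finite M]
    (h : ∀ k : K, (∀ φ : K →* M, φ k = 1) → k = 1) : Finite K := by
  obtain ⟨s, hs⟩ := Group.fg_def.1 ‹Group.FG K›
  have : Finite (K →* M) := by
    refine Finite.of_injective (fun φ : K →* M => fun x : s => φ (x : K)) fun φ ψ hφψ => ?_
    refine MonoidHom.eq_of_eqOn_dense hs fun x hx => congrFun hφψ ⟨x, hx⟩
  let e : K →* ((K →* M) → M) := MonoidHom.pi id
  refine Finite.of_injective e ((injective_iff_map_eq_one e).2 fun k hk => h k fun φ => ?_)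
  exact congrFun hk φ

theorem Subgroup.countable_closure {G : Type*} [Group G] {s : Set G} (hs : s.Countable) :
    Countable (Subgroup.closure s) := by
  have : Countable s := hs
  have : Countable (FreeGroup s) := inferInstanceAs (Countable (Quot _))
  have h := FreeGroup.range_lift_eq_closure (f := ((↑) : s → G))
  rw [Subtype.range_coe] at h
  rw [← h]
  exact (MonoidHom.rangeRestrict_surjective _).countable

/-! ### Permutations preserving the cosets of a finite subgroup. -/

section RightCosets

variable {G : Type*} [Group G]

/-- The permutations of a group that map each right coset of the subgroup `F` to itself. -/
def rightCosetPerm (F : Subgroup G) : Subgroup (Equiv.Perm G) where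
  carrier := {π | ∀ x, π x * x⁻¹ ∈ F}
  one_mem' x := by simp
  mul_mem' {π ρ} hπ hρ x := by
    simpa [mul_assoc] using F.mul_mem (hπ (ρ x)) (hρ x)
  inv_mem' {π} hπ x := by
    simpa using F.inv_mem (hπ (π⁻¹ x))

theorem rightCosetPerm_mono {E F : Subgroup G} (h : E ≤ F) :
    rightCosetPerm E ≤ rightCosetPerm F := fun _ hπ x => h (hπ x)

/-- The action of `rightCosetPerm F` on the right coset of `x`, identified with `F`. -/
def rightCosetHom (F : Subgroup G) (x : G) : rightCosetPerm F →* Equiv.Perm F where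
  toFun π :=
    { toFun := fun f => ⟨π.1 (f * x) * x⁻¹, by
        simpa [mul_assoc] using F.mul_mem (π.2 (f * x)) f.2⟩
      invFun := fun f => ⟨π.1⁻¹ (f * x) * x⁻¹, by
        simpa [mul_assoc] using F.mul_mem ((π⁻¹).2 (f * x)) f.2⟩
      left_inv := fun f => by simp
      right_inv := fun f => by simp }
  map_one' := by ext; simp
  map_mul' π ρ := by ext; simp

/-- Restricting a coordinate to one right coset of `F` gives a homomorphism to the single finite
group `Equiv.Perm F`, and these separate points. The index set `C` may be infinite. -/
theorem finite_of_fg_of_le_pi_rightCosetPerm {C : Type*} (F : Subgroup G) [Finite F]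
    (K : Subgroup (C → Equiv.Perm G)) (hK : K.FG)
    (hle : ∀ p ∈ K, ∀ c, p c ∈ rightCosetPerm F) : Finite K := by
  have : Group.FG K := (Group.fg_iff_subgroup_fg K).2 hK
  refine finite_of_separating_homs (M := Equiv.Perm F) fun k hk => ?_
  ext c x
  let ev : K →* rightCosetPerm F :=
    ((Pi.evalMonoidHom _ c).comp K.subtype).codRestrict _ fun p => hle p p.2 c
  have h := congrArg (fun π : Equiv.Perm F => (π 1 : G)) (hk ((rightCosetHom F x).comp ev))
  change k.1 c ((1 : F) * x) * x⁻¹ = 1 at h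
  simpa [mul_inv_eq_one] using h

end RightCosets

/-! ### Permutations that conjugate left translations, and how automorphisms move them. -/

section Conjugators

/-- Two free actions of a finite group `K` on a finite group by left translations are
isomorphic. -/
theorem exists_perm_semiconj {K F : Type*} [Group K] [Group F] [Finite F] (i j : K →* F)
    (hi : Function.Injective i) (hj : Function.Injective j) :
    ∃ ψ : Equiv.Perm F, ∀ k f, ψ (i k * f) = j k * ψ f := by
  -- The transversals `S` and `T` index the orbits of the two free actions. They have equal size, so
  -- matching them arbitrarily gives `ψ`.
  obtain ⟨S, hS, -⟩ := i.range.exists_isComplement_right 1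
  obtain ⟨T, hT, -⟩ := j.range.exists_isComplement_right 1
  have hc : Nat.card S = Nat.card T := by
    have h1 := hS.card_mul_card
    have h2 := hT.card_mul_card
    have h3 : Nat.card i.range = Nat.card j.range :=
      (Nat.card_congr (MonoidHom.ofInjective hi).toEquiv).symm.trans
        (Nat.card_congr (MonoidHom.ofInjective hj).toEquiv)
    have h4 : 0 < Nat.card j.range := Nat.card_pos
    have h5 : Nat.card j.range * Nat.card S = Nat.card j.range * Nat.card T := by
      rw [← h3]
      exact (h1.trans h2.symm).trans (congrArg (· * _) h3.symm)
    exact Nat.eq_of_mul_eq_mul_left h4 h5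
  let θ : i.range ≃* j.range := (MonoidHom.ofInjective hi).symm.trans (MonoidHom.ofInjective hj)
  have hθ : ∀ k, θ ⟨i k, k, rfl⟩ = ⟨j k, k, rfl⟩ := fun k => by
    have : (⟨i k, k, rfl⟩ : i.range) = MonoidHom.ofInjective hi k := rfl
    rw [this]
    simp only [θ, MulEquiv.trans_apply, MulEquiv.symm_apply_apply]
    rfl
  let e : S ≃ T := (Finite.card_eq.1 hc).some
  refine ⟨hS.equiv.trans ((θ.toEquiv.prodCongr e).trans hT.equiv.symm), fun k f => ?_⟩
  simp only [Equiv.trans_apply]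
  rw [Equiv.symm_apply_eq, Subgroup.IsComplement.equiv_mul_left_of_mem hS ⟨k, rfl⟩,
    Subgroup.IsComplement.equiv_mul_left_of_mem hT ⟨k, rfl⟩, Equiv.apply_symm_apply]
  refine Prod.ext ?_ rfl
  exact (map_mul θ _ _).trans (congrArg (· * _) (hθ k))

variable {G : Type*} [Group G]

/-- The subgroup generated by all the components of a set of pairs. -/
def pairClosure (S : Set (G × G)) : Subgroup G :=
  Subgroup.closure (Prod.fst '' S ∪ Prod.snd '' S)

theorem fst_mem_pairClosure {S : Set (G × G)} {p : G × G} (hp : p ∈ S) : p.1 ∈ pairClosure S :=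
  Subgroup.subset_closure (Or.inl ⟨p, hp, rfl⟩)

theorem snd_mem_pairClosure {S : Set (G × G)} {p : G × G} (hp : p ∈ S) : p.2 ∈ pairClosure S :=
  Subgroup.subset_closure (Or.inr ⟨p, hp, rfl⟩)

theorem IsLocallyFiniteGroup.finite_pairClosure (hG : IsLocallyFiniteGroup G)
    {S : Set (G × G)} (hS : S.Finite) : Finite (pairClosure S) :=
  isLocallyFiniteGroup_iff.1 hG _ ((hS.image _).union (hS.image _))

/-- The permutation `π` conjugates the left translation by `a` to that by `b` for all
`(a, b) ∈ S`, and preserves the right cosets of the subgroup generated by `S`. -/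
structure IsConjugator (S : Set (G × G)) (π : Equiv.Perm G) : Prop where
  mem_rightCosetPerm : π ∈ rightCosetPerm (pairClosure S)
  semiconj : ∀ p ∈ S, ∀ x, π (p.1 * x) = p.2 * π x

/-- Both images lie in the finite group `F`, where the two free actions are isomorphic by some `ψ`.
A transversal of `F` copies `ψ` to every right coset. -/
theorem exists_isConjugator (hG : IsLocallyFiniteGroup G) {K : Type*} [Group K] [Finite K]
    (i j : K →* G) (hi : Function.Injective i) (hj : Function.Injective j) :
    ∃ π, IsConjugator (Set.range fun k => (i k, j k)) π := by
  set S : Set (G × G) := Set.range fun k => (i k, j k)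
  set F := pairClosure S
  have : Finite F := hG.finite_pairClosure (Set.finite_range _)
  have hiF : ∀ k, i k ∈ F := fun k => fst_mem_pairClosure (S := S) ⟨k, rfl⟩
  have hjF : ∀ k, j k ∈ F := fun k => snd_mem_pairClosure (S := S) ⟨k, rfl⟩
  obtain ⟨ψ, hψ⟩ := exists_perm_semiconj (i.codRestrict F hiF) (j.codRestrict F hjF)
    (fun a b h => hi (congrArg Subtype.val h)) (fun a b h => hj (congrArg Subtype.val h))
  obtain ⟨T, hT, -⟩ := F.exists_isComplement_right 1
  let π : Equiv.Perm G := hT.equiv.trans ((ψ.prodCongr (Equiv.refl T)).trans hT.equiv.symm)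
  have hπ : ∀ x, π x = ψ (hT.equiv x).1 * (hT.equiv x).2 := fun x => rfl
  refine ⟨π, fun x => ?_, ?_⟩
  · rw [hπ, Subgroup.IsComplement.equiv_snd_eq_inv_mul]
    have : (ψ (hT.equiv x).1 : G) * (((hT.equiv x).1 : G)⁻¹ * x) * x⁻¹ =
      (ψ (hT.equiv x).1 : G) * ((hT.equiv x).1 : G)⁻¹ := by group
    rw [this]
    exact F.mul_mem (SetLike.coe_mem _) (F.inv_mem (SetLike.coe_mem (hT.equiv x).1))
  · rintro _ ⟨k, rfl⟩ x
    have h := congrArg Subtype.val (hψ k (hT.equiv x).1)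
    rw [hπ, hπ, Subgroup.IsComplement.equiv_mul_left_of_mem hT (hiF k), ← mul_assoc]
    exact congrArg (· * ((hT.equiv x).2 : G)) h

/-- The pairs that an automorphism maps into `S`. -/
def pairPreimage (σ : MulAut G) (S : Set (G × G)) : Set (G × G) := {p | (σ p.1, σ p.2) ∈ S}

theorem Set.Finite.pairPreimage {S : Set (G × G)} (hS : S.Finite) (σ : MulAut G) :
    (pairPreimage σ S).Finite :=
  hS.preimage (σ.injective.prodMap σ.injective).injOn

/-- Conjugation of a permutation of a group by an automorphism. -/
def autConjPerm : MulAut G →* MulAut (Equiv.Perm G) :=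
  MulAut.conj.comp (MulAut.toPerm G)

@[simp]
theorem autConjPerm_apply (σ : MulAut G) (π : Equiv.Perm G) (x : G) :
    autConjPerm σ π x = σ (π (σ⁻¹ x)) := rfl

theorem autConjPerm_mem_rightCosetPerm {σ : MulAut G} {E F : Subgroup G}
    (h : E ≤ F.comap σ.toMonoidHom) {π : Equiv.Perm G} (hπ : π ∈ rightCosetPerm E) :
    autConjPerm σ π ∈ rightCosetPerm F := by
  intro x
  have := h (hπ (σ⁻¹ x))
  simpa [Subgroup.mem_comap] using this

theorem IsConjugator.autConjPerm {σ : MulAut G} {S : Set (G × G)} {π : Equiv.Perm G}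
    (hπ : IsConjugator (pairPreimage σ S) π) : IsConjugator S (autConjPerm σ π) where
  mem_rightCosetPerm := by
    refine autConjPerm_mem_rightCosetPerm ?_ hπ.mem_rightCosetPerm
    refine (Subgroup.closure_le _).2 ?_
    rintro _ (⟨p, hp, rfl⟩ | ⟨p, hp, rfl⟩)
    · exact fst_mem_pairClosure (p := (σ p.1, σ p.2)) hp
    · exact snd_mem_pairClosure (p := (σ p.1, σ p.2)) hp
  semiconj p hp x := by
    have := hπ.semiconj (σ⁻¹ p.1, σ⁻¹ p.2) (by simpa [pairPreimage] using hp) (σ⁻¹ x)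
    simp only [autConjPerm_apply, map_mul, this, MulAut.apply_inv_self]

theorem pairPreimage_inv_pairPreimage (σ : MulAut G) (S : Set (G × G)) :
    pairPreimage σ⁻¹ (pairPreimage σ S) = S := by
  ext p
  simp [pairPreimage]

theorem exists_isConjugator_pairPreimage {σ : MulAut G} {S : Set (G × G)}
    (h : ∃ π, IsConjugator S π) : ∃ π, IsConjugator (pairPreimage σ S) π := by
  obtain ⟨π, hπ⟩ := h
  refine ⟨_, IsConjugator.autConjPerm (σ := σ⁻¹) (π := π) ?_⟩
  rwa [pairPreimage_inv_pairPreimage]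

/-! ### The extension indexed by all choices of conjugators. -/

variable (G) in
/-- The functions that choose a conjugator for each set of pairs that has one. -/
def ConjugatorChoice : Type _ :=
  {c : Set (G × G) → Equiv.Perm G // ∀ S, (∃ π, IsConjugator S π) → IsConjugator S (c S)}

instance : Nonempty (ConjugatorChoice G) := by
  classical
  exact ⟨⟨fun S => if h : ∃ π, IsConjugator S π then h.choose else 1, fun S h => by
    simpa [dif_pos h] using h.choose_spec⟩⟩

/-- No single choice need be fixed by the automorphisms, but the set of all choices is stable
because `IsConjugator` is an invariant notion. -/
instance : MulAction (MulAut G) (ConjugatorChoice G) where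
  smul σ c := ⟨fun S => autConjPerm σ (c.1 (pairPreimage σ S)), fun _ h =>
    (c.2 _ (exists_isConjugator_pairPreimage h)).autConjPerm⟩
  one_smul _ := rfl
  mul_smul _ _ _ := rfl

theorem ConjugatorChoice.smul_val (σ : MulAut G) (c : ConjugatorChoice G) (S : Set (G × G)) :
    (σ • c).1 S = _root_.autConjPerm σ (c.1 (pairPreimage σ S)) := rfl

/-- Automorphisms of `G` act on families of permutations of `G` indexed by the choices of
conjugators. -/
def autConjFamily : MulAut G →* MulAut (ConjugatorChoice G → Equiv.Perm G) where
  toFun σ :=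
    { toFun := fun p c => autConjPerm σ (p (σ⁻¹ • c))
      invFun := fun p c => autConjPerm σ⁻¹ (p (σ • c))
      left_inv := fun p => by ext; simp
      right_inv := fun p => by ext; simp
      map_mul' := fun p q => by ext; simp }
  map_one' := by ext; simp
  map_mul' σ τ := by ext; simp [mul_smul]

theorem autConjFamily_apply (σ : MulAut G) (p : ConjugatorChoice G → Equiv.Perm G)
    (c : ConjugatorChoice G) : autConjFamily σ p c = autConjPerm σ (p (σ⁻¹ • c)) := rfl

/-- Left translation by an element of `G`, as a constant family. -/
def leftFamily : G →* (ConjugatorChoice G → Equiv.Perm G) where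
  toFun g _ := Equiv.mulLeft g
  map_one' := by ext; simp
  map_mul' a b := by ext; simp

theorem leftFamily_apply (g : G) (c : ConjugatorChoice G) (x : G) :
    leftFamily g c x = g * x := rfl

/-- The family whose value at a choice of conjugators is the conjugator chosen for `S`. -/
def choiceFamily (S : Set (G × G)) : ConjugatorChoice G → Equiv.Perm G := fun c => c.1 S

theorem autConjFamily_leftFamily (σ : MulAut G) (g : G) :
    autConjFamily σ (leftFamily g) = leftFamily (σ g) := by
  ext c x
  simp [autConjFamily_apply, leftFamily_apply]

/-- The twist of the index by `σ⁻¹` cancels the conjugation by `σ`, so automorphisms permute the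
generators of the extension. -/
theorem autConjFamily_choiceFamily (σ : MulAut G) (S : Set (G × G)) :
    autConjFamily σ (choiceFamily S) = choiceFamily (pairPreimage σ⁻¹ S) := by
  ext c x
  simp [autConjFamily_apply, choiceFamily, ConjugatorChoice.smul_val]

variable (G) in
/-- The left translations, and the conjugators of the finite sets of pairs that have one. -/
def conjugatorGenerators : Set (ConjugatorChoice G → Equiv.Perm G) :=
  Set.range leftFamily ∪ choiceFamily '' {S | S.Finite ∧ ∃ π, IsConjugator S π}

variable (G) in
/-- An extension of `G` in which any two isomorphic finite subgroups of `G` are conjugate, and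
to which all automorphisms of `G` extend canonically. -/
def ConjugatorExtension : Subgroup (ConjugatorChoice G → Equiv.Perm G) :=
  Subgroup.closure (conjugatorGenerators G)

namespace ConjugatorExtension

variable (G) in
/-- The embedding of `G` into its extension. -/
def of : G →* ConjugatorExtension G :=
  leftFamily.codRestrict _ fun g => Subgroup.subset_closure (Or.inl ⟨g, rfl⟩)

theorem of_injective : Function.Injective (of G) := fun a b h => by
  obtain ⟨c⟩ : Nonempty (ConjugatorChoice G) := inferInstance
  have := congrArg (fun p : ConjugatorExtension G => p.1 c 1) h
  simpa using (leftFamily_apply a c 1).symm.trans (this.trans (leftFamily_apply b c 1))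

/-- The conjugating element is `choiceFamily` of the graph of the isomorphism: each of its
coordinates is a conjugator by definition of a choice. -/
theorem exists_conj_of (hG : IsLocallyFiniteGroup G) {K : Type*} [Group K] [Finite K]
    (i j : K →* G) (hi : Function.Injective i) (hj : Function.Injective j) :
    ∃ t : ConjugatorExtension G, ∀ k, t * of G (i k) * t⁻¹ = of G (j k) := by
  have h := exists_isConjugator hG i j hi hj
  refine ⟨⟨choiceFamily _, Subgroup.subset_closure
    (Or.inr ⟨_, ⟨Set.finite_range fun k => (i k, j k), h⟩, rfl⟩)⟩, fun k => ?_⟩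
  rw [mul_inv_eq_iff_eq_mul]
  ext c x
  exact (c.2 _ h).semiconj (i k, j k) ⟨k, rfl⟩ x

instance [Countable G] : Countable (ConjugatorExtension G) := by
  refine Subgroup.countable_closure ((Set.countable_range _).union (Set.Countable.image ?_ _))
  exact Set.Countable.mono (fun S hS => hS.1) Set.Countable.ofPred_finite

/-- The subgroup `F` is uniform in `c`: the coset condition in `IsConjugator` depends on `S` and not
on the conjugator chosen. -/
theorem exists_finite_le (hG : IsLocallyFiniteGroup G) {p : ConjugatorChoice G → Equiv.Perm G}
    (hp : p ∈ ConjugatorExtension G) :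
    ∃ F : Subgroup G, Finite F ∧ ∀ c, p c ∈ rightCosetPerm F := by
  induction hp using Subgroup.closure_induction with
  | mem p hp =>
    rcases hp with ⟨g, rfl⟩ | ⟨S, ⟨hS, h⟩, rfl⟩
    · refine ⟨Subgroup.closure {g}, isLocallyFiniteGroup_iff.1 hG _ (Set.finite_singleton g),
        fun c x => ?_⟩
      simp [leftFamily_apply]
    · exact ⟨_, hG.finite_pairClosure hS, fun c => (c.2 S h).mem_rightCosetPerm⟩
  | one => exact ⟨⊥, inferInstance, fun c => one_mem _⟩
  | mul p q _ _ hp hq =>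
    obtain ⟨E, _, hE⟩ := hp
    obtain ⟨F, _, hF⟩ := hq
    exact ⟨E ⊔ F, hG.finite_sup E F, fun c => mul_mem (rightCosetPerm_mono le_sup_left (hE c))
      (rightCosetPerm_mono le_sup_right (hF c))⟩
  | inv p _ hp =>
    obtain ⟨E, hE, h⟩ := hp
    exact ⟨E, hE, fun c => inv_mem (h c)⟩

theorem isLocallyFiniteGroup (hG : IsLocallyFiniteGroup G) :
    IsLocallyFiniteGroup (ConjugatorExtension G) := by
  rw [isLocallyFiniteGroup_iff]
  intro s hs
  choose F hF hsF using fun p : ConjugatorExtension G => exists_finite_le hG p.2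
  have hE : Finite (Subgroup.closure (⋃ p ∈ s, (F p : Set G))) :=
    isLocallyFiniteGroup_iff.1 hG _ (hs.biUnion fun p _ => Set.toFinite _)
  set E := Subgroup.closure (⋃ p ∈ s, (F p : Set G))
  have hFE : ∀ p ∈ s, F p ≤ E := fun p hp x hx =>
    Subgroup.subset_closure (Set.mem_biUnion hp hx)
  have := finite_of_fg_of_le_pi_rightCosetPerm E
    (Subgroup.closure ((ConjugatorExtension G).subtype '' s))
    ((Subgroup.fg_iff _).2 ⟨_, rfl, hs.image _⟩) (by
      intro p hp c
      induction hp using Subgroup.closure_induction with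
      | mem p hp =>
        obtain ⟨p, hp, rfl⟩ := hp
        exact rightCosetPerm_mono (hFE p hp) (hsF p c)
      | one => exact one_mem _
      | mul p q _ _ hp hq => exact mul_mem hp hq
      | inv p _ hp => exact inv_mem hp)
  rw [← MonoidHom.map_closure] at this
  exact Finite.of_equiv _ ((Subgroup.closure s).equivMapOfInjective _
    (ConjugatorExtension G).subtype_injective).symm.toEquiv

theorem autConjFamily_mem (σ : MulAut G) {p : ConjugatorChoice G → Equiv.Perm G}
    (hp : p ∈ ConjugatorExtension G) : autConjFamily σ p ∈ ConjugatorExtension G := by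
  have : ConjugatorExtension G ≤
      (ConjugatorExtension G).comap (autConjFamily σ).toMonoidHom := by
    refine (Subgroup.closure_le _).2 ?_
    rintro _ (⟨g, rfl⟩ | ⟨S, ⟨hS, h⟩, rfl⟩)
    · exact Subgroup.subset_closure (Or.inl ⟨σ g, (autConjFamily_leftFamily σ g).symm⟩)
    · exact Subgroup.subset_closure (Or.inr ⟨pairPreimage σ⁻¹ S,
        ⟨hS.pairPreimage _, exists_isConjugator_pairPreimage h⟩,
        (autConjFamily_choiceFamily σ S).symm⟩)
  exact this hp

variable (G) in
/-- The canonical extension of automorphisms of `G` to its extension. -/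
def autHom : MulAut G →* MulAut (ConjugatorExtension G) where
  toFun σ :=
    { toFun := fun p => ⟨autConjFamily σ p, autConjFamily_mem σ p.2⟩
      invFun := fun p => ⟨autConjFamily σ⁻¹ p, autConjFamily_mem σ⁻¹ p.2⟩
      left_inv := fun p => by simp
      right_inv := fun p => by simp
      map_mul' := fun p q => by simp }
  map_one' := by ext; simp
  map_mul' σ τ := by ext; simp

theorem autHom_of (σ : MulAut G) (g : G) : autHom G σ (of G g) = of G (σ g) :=
  Subtype.ext (autConjFamily_leftFamily σ g)

end ConjugatorExtension

end Conjugators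

theorem MonoidHom.finite_range_of_finite {K H : Type*} [Group K] [Finite K] [Group H] (f : K →* H) :
    Finite f.range :=
  Finite.of_surjective _ f.rangeRestrict_surjective

/-! ### Homogeneity of Hall's group for embeddings of finite groups. -/

namespace IsHallUniversalGroup

variable {H : Type*} [Group H]

theorem exists_injective_hom (hH : IsHallUniversalGroup H) (K : Type*) [Group K] [Finite K] :
    ∃ f : K →* H, Function.Injective f := by
  obtain ⟨f, hf⟩ := hH.embeds_finite (Shrink.{0} K)
  exact ⟨f.comp (Shrink.mulEquiv.{0} (α := K)).symm.toMonoidHom,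
    hf.comp (Shrink.mulEquiv.{0} (α := K)).symm.injective⟩

/-- An embedding of a finite group is conjugate to the restriction of any embedding of
its symmetric group. -/
theorem exists_conj_eq_cayley (hH : IsHallUniversalGroup H) {K : Type*} [Group K] [Finite K]
    (i : K →* H) (hi : Function.Injective i) (e : Equiv.Perm K →* H)
    (he : Function.Injective e) : ∃ h : H, ∀ k, h * i k * h⁻¹ = e (Equiv.mulLeft k) := by
  let l : K →* H := e.comp (MulAction.toPermHom K K)
  have hl : Function.Injective l := he.comp MulAction.toPerm_injective
  obtain ⟨h, hh⟩ := hH.conj_of_iso i.range l.range i.finite_range_of_finite l.finite_range_of_finite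
    ⟨(MonoidHom.ofInjective hi).symm.trans (MonoidHom.ofInjective hl)⟩
  let c : K →* H := (MulAut.conj h).toMonoidHom.comp i
  have hc : Function.Injective c := (MulAut.conj h).injective.comp hi
  have hcl : c.range = l.range := by rw [← hh, MonoidHom.range_comp]
  -- Conjugacy of the images matches the embeddings only up to an automorphism `α` of `K`. It is
  -- undone inside `Equiv.Perm K`, where `α` conjugates the translation by `k` to that by `α k`.
  let α : K ≃* K := (MonoidHom.ofInjective hc).trans
    ((MulEquiv.subgroupCongr hcl).trans (MonoidHom.ofInjective hl).symm)
  have hα : ∀ k, l (α k) = c k := fun k => by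
    have : MonoidHom.ofInjective hl (α k) =
        MulEquiv.subgroupCongr hcl (MonoidHom.ofInjective hc k) := by simp [α]
    exact congrArg Subtype.val this
  have hlα : ∀ k, l (α k) = e α.toEquiv * l k * (e α.toEquiv)⁻¹ := fun k => by
    simp only [l, MonoidHom.comp_apply, ← map_inv, ← map_mul]
    congr 1
    ext x
    simp [Equiv.Perm.inv_def, MulAction.toPermHom_apply]
  refine ⟨(e α.toEquiv)⁻¹ * h, fun k => ?_⟩
  have h1 : h * i k * h⁻¹ = e α.toEquiv * l k * (e α.toEquiv)⁻¹ := (hα k).symm.trans (hlα k)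
  have h2 : l k = e (Equiv.mulLeft k) := rfl
  rw [← h2, mul_inv_rev, inv_inv]
  calc (e α.toEquiv)⁻¹ * h * i k * (h⁻¹ * e α.toEquiv)
      = (e α.toEquiv)⁻¹ * (h * i k * h⁻¹) * e α.toEquiv := by group
    _ = l k := by rw [h1]; group

/-- Any two embeddings of a finite group are conjugate. -/
theorem exists_conj_eq (hH : IsHallUniversalGroup H) {K : Type*} [Group K] [Finite K]
    (i j : K →* H) (hi : Function.Injective i) (hj : Function.Injective j) :
    ∃ h : H, ∀ k, h * i k * h⁻¹ = j k := by
  obtain ⟨e, he⟩ := hH.exists_injective_hom (Equiv.Perm K)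
  obtain ⟨a, ha⟩ := hH.exists_conj_eq_cayley i hi e he
  obtain ⟨b, hb⟩ := hH.exists_conj_eq_cayley j hj e he
  refine ⟨b⁻¹ * a, fun k => ?_⟩
  calc b⁻¹ * a * i k * (b⁻¹ * a)⁻¹ = b⁻¹ * (a * i k * a⁻¹) * b := by group
    _ = b⁻¹ * (b * j k * b⁻¹) * b := by rw [ha, hb]
    _ = j k := by group

end IsHallUniversalGroup

/-! ### Uniqueness of Hall's group by back-and-forth. -/

/-- A finite subgroup of a product that is the graph of an isomorphism between subgroups of the
factors. -/
structure IsFinitePartialIso {H K : Type*} [Group H] [Group K] (Γ : Subgroup (H × K)) : Prop where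
  finite : Finite Γ
  injOn_fst : Set.InjOn Prod.fst (Γ : Set (H × K))
  injOn_snd : Set.InjOn Prod.snd (Γ : Set (H × K))

namespace IsFinitePartialIso

variable {H K : Type*} [Group H] [Group K] {Γ : Subgroup (H × K)}

theorem bot : IsFinitePartialIso (⊥ : Subgroup (H × K)) :=
  ⟨inferInstance, by simp, by simp⟩

theorem swap (h : IsFinitePartialIso Γ) :
    IsFinitePartialIso (Γ.map (MulEquiv.prodComm (M := H) (N := K)).toMonoidHom) := by
  have := h.finite
  refine ⟨?_, ?_, ?_⟩
  · rw [← Γ.range_subtype, MonoidHom.map_range]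
    exact MonoidHom.finite_range_of_finite _
  · rintro _ ⟨p, hp, rfl⟩ _ ⟨q, hq, rfl⟩ hpq
    exact congrArg Prod.swap (h.injOn_snd hp hq hpq)
  · rintro _ ⟨p, hp, rfl⟩ _ ⟨q, hq, rfl⟩ hpq
    exact congrArg Prod.swap (h.injOn_fst hp hq hpq)

/-- Any embedding `e` of the enlarged finite domain `A` into `K` becomes an extension of `Γ` after
conjugation by some `t`, by homogeneity. -/
theorem exists_le_fst (h : IsFinitePartialIso Γ) (hH : IsLocallyFiniteGroup H)
    (hK : IsHallUniversalGroup K) (x : H) :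
    ∃ Δ, IsFinitePartialIso Δ ∧ Γ ≤ Δ ∧ ∃ y, (x, y) ∈ Δ := by
  have := h.finite
  let A := Subgroup.closure (insert x (Prod.fst '' (Γ : Set (H × K))))
  have : Finite A := isLocallyFiniteGroup_iff.1 hH _
    ((Set.Finite.image _ (Set.toFinite _)).insert x)
  obtain ⟨e, he⟩ := hK.exists_injective_hom A
  let ι : Γ →* A := ((MonoidHom.fst H K).comp Γ.subtype).codRestrict A fun p =>
    Subgroup.subset_closure (Or.inr ⟨p, p.2, rfl⟩)
  have hι : Function.Injective ι := fun p q hpq =>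
    Subtype.ext (h.injOn_fst p.2 q.2 (congrArg Subtype.val hpq))
  obtain ⟨t, ht⟩ := hK.exists_conj_eq (e.comp ι) ((MonoidHom.snd H K).comp Γ.subtype)
    (he.comp hι) fun p q hpq => Subtype.ext (h.injOn_snd p.2 q.2 hpq)
  let g : A →* H × K := A.subtype.prod ((MulAut.conj t).toMonoidHom.comp e)
  refine ⟨g.range, ⟨g.finite_range_of_finite, ?_, ?_⟩, fun p hp => ⟨ι ⟨p, hp⟩, ?_⟩,
    t * e ⟨x, Subgroup.subset_closure (Or.inl rfl)⟩ * t⁻¹,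
    ⟨x, Subgroup.subset_closure (Or.inl rfl)⟩, rfl⟩
  · rintro _ ⟨a, rfl⟩ _ ⟨b, rfl⟩ hab
    exact congrArg g (Subtype.ext hab)
  · rintro _ ⟨a, rfl⟩ _ ⟨b, rfl⟩ hab
    exact congrArg g (he ((MulAut.conj t).injective hab))
  · exact Prod.ext rfl (ht ⟨p, hp⟩)

theorem exists_le_snd (h : IsFinitePartialIso Γ) (hH : IsHallUniversalGroup H)
    (hK : IsLocallyFiniteGroup K) (y : K) :
    ∃ Δ, IsFinitePartialIso Δ ∧ Γ ≤ Δ ∧ ∃ x, (x, y) ∈ Δ := by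
  obtain ⟨Δ, hΔ, hle, x, hx⟩ := h.swap.exists_le_fst hK hH y
  exact ⟨_, hΔ.swap, fun p hp => ⟨p.swap, hle ⟨p, hp, rfl⟩, rfl⟩, x, (y, x), hx, rfl⟩

end IsFinitePartialIso

/-- Hall's universal group is unique up to isomorphism. -/
theorem IsHallUniversalGroup.nonempty_mulEquiv {H K : Type*} [Group H] [Group K]
    (hH : IsHallUniversalGroup H) (hK : IsHallUniversalGroup K) : Nonempty (H ≃* K) := by
  have := hH.countable
  have := hK.countable
  let _ : Encodable (H ⊕ K) := Encodable.ofCountable _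
  let P := {Γ : Subgroup (H × K) // IsFinitePartialIso Γ}
  -- Each element of `H` or `K` gives a cofinal set of partial isomorphisms. A chain meeting all of
  -- these countably many sets has a total bijection as its union.
  let D : H ⊕ K → Order.Cofinal P := Sum.elim
    (fun x => ⟨{Γ | ∃ y, (x, y) ∈ Γ.1}, fun Γ => by
      obtain ⟨Δ, hΔ, hle, hx⟩ := Γ.2.exists_le_fst hH.locallyFinite hK x
      exact ⟨⟨Δ, hΔ⟩, hx, hle⟩⟩)
    (fun y => ⟨{Γ | ∃ x, (x, y) ∈ Γ.1}, fun Γ => by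
      obtain ⟨Δ, hΔ, hle, hx⟩ := Γ.2.exists_le_snd hH hK.locallyFinite y
      exact ⟨⟨Δ, hΔ⟩, hx, hle⟩⟩)
  let Γ : ℕ → P := Order.sequenceOfCofinals ⟨⊥, .bot⟩ D
  have hmono : Monotone fun n => (Γ n).1 :=
    fun _ _ hmn => Order.sequenceOfCofinals.monotone _ D hmn
  let U : Subgroup (H × K) := ⨆ n, (Γ n).1
  have hU : ∀ {p}, p ∈ U ↔ ∃ n, p ∈ (Γ n).1 := fun {p} =>
    Subgroup.mem_iSup_of_directed hmono.directed_le
  have hU₂ : ∀ p q : U, ∃ n, p.1 ∈ (Γ n).1 ∧ q.1 ∈ (Γ n).1 := fun p q => by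
    obtain ⟨m, hm⟩ := hU.1 p.2
    obtain ⟨n, hn⟩ := hU.1 q.2
    exact ⟨max m n, hmono (le_max_left m n) hm, hmono (le_max_right m n) hn⟩
  have hfst : Function.Bijective ((MonoidHom.fst H K).comp U.subtype) := by
    refine ⟨fun p q hpq => ?_, fun x => ?_⟩
    · obtain ⟨n, hp, hq⟩ := hU₂ p q
      exact Subtype.ext ((Γ n).2.injOn_fst hp hq hpq)
    · obtain ⟨y, hy⟩ := Order.sequenceOfCofinals.encode_mem ⟨⊥, .bot⟩ D (Sum.inl x)
      exact ⟨⟨(x, y), hU.2 ⟨_, hy⟩⟩, rfl⟩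
  have hsnd : Function.Bijective ((MonoidHom.snd H K).comp U.subtype) := by
    refine ⟨fun p q hpq => ?_, fun y => ?_⟩
    · obtain ⟨n, hp, hq⟩ := hU₂ p q
      exact Subtype.ext ((Γ n).2.injOn_snd hp hq hpq)
    · obtain ⟨x, hx⟩ := Order.sequenceOfCofinals.encode_mem ⟨⊥, .bot⟩ D (Sum.inr y)
      exact ⟨⟨(x, y), hU.2 ⟨_, hx⟩⟩, rfl⟩
  exact ⟨(MulEquiv.ofBijective _ hfst).symm.trans (MulEquiv.ofBijective _ hsnd)⟩

/-! ### The tower of extensions and its limit. -/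

section Tower

universe u

variable (G : Type u) [Group G]

/-- The iterated extensions of `G`. -/
def conjugatorTower : ℕ → GrpCat.{u}
  | 0 => GrpCat.of G
  | n + 1 => GrpCat.of (ConjugatorExtension (conjugatorTower n))

namespace conjugatorTower

/-- The embedding of a stage of the tower into the next one. -/
def step (n : ℕ) : conjugatorTower G n →* conjugatorTower G (n + 1) :=
  ConjugatorExtension.of (conjugatorTower G n)

theorem step_injective (n : ℕ) : Function.Injective (step G n) :=
  ConjugatorExtension.of_injective

/-- The embeddings between the stages of the tower. -/
def transition (m n : ℕ) (h : m ≤ n) : conjugatorTower G m →* conjugatorTower G n :=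
  Nat.leRecOn h (C := fun n => conjugatorTower G m →* conjugatorTower G n)
    (fun {k} g => (step G k).comp g) (MonoidHom.id _)

theorem transition_self (m : ℕ) : transition G m m le_rfl = MonoidHom.id _ :=
  Nat.leRecOn_self _

theorem transition_succ {m n : ℕ} (h : m ≤ n) :
    transition G m (n + 1) (h.trans n.le_succ) = (step G n).comp (transition G m n h) :=
  Nat.leRecOn_succ h _

theorem transition_step (n : ℕ) : transition G n (n + 1) n.le_succ = step G n := by
  rw [transition_succ G le_rfl, transition_self, MonoidHom.comp_id]

theorem transition_transition {l m n : ℕ} (hlm : l ≤ m) (hmn : m ≤ n) (x : conjugatorTower G l) :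
    transition G m n hmn (transition G l m hlm x) = transition G l n (hlm.trans hmn) x := by
  induction n, hmn using Nat.le_induction with
  | base => rw [transition_self]; rfl
  | succ n hmn ih =>
    rw [transition_succ G hmn, transition_succ G (hlm.trans hmn), MonoidHom.comp_apply,
      MonoidHom.comp_apply, ih]

theorem transition_injective (m n : ℕ) (h : m ≤ n) : Function.Injective (transition G m n h) := by
  induction n, h using Nat.le_induction with
  | base => rw [transition_self]; exact Function.injective_id
  | succ n h ih =>
    rw [transition_succ G h]
    exact (step_injective G n).comp ih

instance : DirectedSystem (fun n => conjugatorTower G n) (transition G · · ·) where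
  map_self m x := by rw [transition_self]; rfl
  map_map _ _ _ hij hjk x := transition_transition G hij hjk x

theorem isLocallyFiniteGroup {G : Type u} [Group G] (hG : IsLocallyFiniteGroup G) (n : ℕ) :
    IsLocallyFiniteGroup (conjugatorTower G n) := by
  induction n with
  | zero => exact hG
  | succ n ih => exact ConjugatorExtension.isLocallyFiniteGroup ih

instance [hG : Countable G] (n : ℕ) : Countable (conjugatorTower G n) := by
  induction n with
  | zero => exact hG
  | succ n ih => exact inferInstanceAs (Countable (ConjugatorExtension (conjugatorTower G n)))

/-- The action of the automorphisms of `G` on the stages of the tower. -/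
def autHom : ∀ n, MulAut G →* MulAut (conjugatorTower G n)
  | 0 => MonoidHom.id _
  | n + 1 => (ConjugatorExtension.autHom (conjugatorTower G n)).comp (autHom n)

theorem autHom_transition (σ : MulAut G) {m n : ℕ} (h : m ≤ n) (x : conjugatorTower G m) :
    autHom G n σ (transition G m n h x) = transition G m n h (autHom G m σ x) := by
  induction n, h using Nat.le_induction with
  | base => rw [transition_self]; rfl
  | succ n h ih =>
    rw [transition_succ G h, MonoidHom.comp_apply, MonoidHom.comp_apply, ← ih]
    exact ConjugatorExtension.autHom_of _ _

end conjugatorTower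

open conjugatorTower

/-- The union of the tower of iterated extensions of `G`. -/
abbrev ConjugatorLimit : Type u :=
  DirectLimit (fun n => conjugatorTower G n) (transition G)

namespace ConjugatorLimit

/-- The embedding of a stage of the tower into the limit. -/
def of (n : ℕ) : conjugatorTower G n →* ConjugatorLimit G where
  toFun x := ⟦⟨n, x⟩⟧
  map_one' := (DirectLimit.one_def (f := transition G) n).symm
  map_mul' x y := (DirectLimit.mul_def (f := transition G) n x y).symm

theorem of_injective (n : ℕ) : Function.Injective (of G n) :=
  DirectLimit.mk_injective (transition G) (transition_injective G) n

theorem of_transition {m n : ℕ} (h : m ≤ n) (x : conjugatorTower G m) :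
    of G n (transition G m n h x) = of G m x :=
  DirectLimit.mk_apply (F := fun n => conjugatorTower G n) (f := transition G) m n x h

theorem range_of_mono : Monotone fun n => (of G n).range := by
  rintro m n h _ ⟨x, rfl⟩
  exact ⟨_, of_transition G h x⟩

theorem exists_mem_range_of (z : ConjugatorLimit G) : ∃ n, z ∈ (of G n).range := by
  obtain ⟨n, x, rfl⟩ := DirectLimit.exists_eq_mk (transition G) z
  exact ⟨n, x, rfl⟩

theorem exists_subset_range_of {s : Set (ConjugatorLimit G)} (hs : s.Finite) :
    ∃ n, s ⊆ (of G n).range := by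
  choose n hn using exists_mem_range_of G
  obtain ⟨N, hN⟩ := (hs.image n).bddAbove
  exact ⟨N, fun z hz => range_of_mono G (hN ⟨z, hz, rfl⟩) (hn z)⟩

instance [Countable G] : Countable (ConjugatorLimit G) :=
  inferInstanceAs (Countable (Quotient _))

theorem isLocallyFiniteGroup {G : Type u} [Group G] (hG : IsLocallyFiniteGroup G) :
    IsLocallyFiniteGroup (ConjugatorLimit G) := by
  rw [isLocallyFiniteGroup_iff]
  intro s hs
  obtain ⟨n, hn⟩ := exists_subset_range_of G hs
  have : Finite (Subgroup.closure (of G n ⁻¹' s)) :=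
    isLocallyFiniteGroup_iff.1 (conjugatorTower.isLocallyFiniteGroup hG n) _
      (hs.preimage (of_injective G n).injOn)
  have h := MonoidHom.map_closure (of G n) (of G n ⁻¹' s)
  rw [Set.image_preimage_eq_of_subset hn] at h
  rw [← h, ← (Subgroup.closure (of G n ⁻¹' s)).range_subtype, MonoidHom.map_range]
  exact MonoidHom.finite_range_of_finite _

/-- Both finite images lie in one stage `n`, and the conjugating element is found in stage `n + 1`.
-/
theorem exists_conj_eq {G : Type u} [Group G] (hG : IsLocallyFiniteGroup G)
    {K : Type*} [Group K] [Finite K] (i j : K →* ConjugatorLimit G)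
    (hi : Function.Injective i) (hj : Function.Injective j) :
    ∃ t, ∀ k, t * i k * t⁻¹ = j k := by
  obtain ⟨n, hn⟩ := exists_subset_range_of G ((Set.finite_range i).union (Set.finite_range j))
  let r := (MonoidHom.ofInjective (of_injective G n)).symm
  have hr : ∀ z, of G n (r z) = z := fun z =>
    congrArg Subtype.val ((MonoidHom.ofInjective (of_injective G n)).apply_symm_apply z)
  let i' := i.codRestrict (of G n).range fun k => hn (Or.inl ⟨k, rfl⟩)
  let j' := j.codRestrict (of G n).range fun k => hn (Or.inr ⟨k, rfl⟩)
  obtain ⟨t : conjugatorTower G (n + 1), ht⟩ := ConjugatorExtension.exists_conj_of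
    (conjugatorTower.isLocallyFiniteGroup hG n) (r.toMonoidHom.comp i') (r.toMonoidHom.comp j')
    (r.injective.comp fun a b h => hi (congrArg Subtype.val h))
    (r.injective.comp fun a b h => hj (congrArg Subtype.val h))
  have hs : ∀ z, of G (n + 1) (step G n (r z)) = z := fun z => by
    rw [← transition_step, of_transition, hr]
  refine ⟨of G (n + 1) t, fun k => ?_⟩
  have h : t * step G n (r (i' k)) * t⁻¹ = step G n (r (j' k)) := ht k
  have h1 := hs (i' k)
  have h2 := hs (j' k)
  calc of G (n + 1) t * i k * (of G (n + 1) t)⁻¹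
      = of G (n + 1) t * of G (n + 1) (step G n (r (i' k))) * (of G (n + 1) t)⁻¹ := by
        rw [h1]; rfl
    _ = of G (n + 1) (step G n (r (j' k))) := by rw [← h, map_mul, map_mul, map_inv]
    _ = j k := h2

/-- The tower forces conjugacy and keeps the group countable and locally finite. Copies of the
finite groups must already be in `G`. -/
theorem isHallUniversalGroup {G : Type u} [Group G] [Countable G] (hG : IsLocallyFiniteGroup G)
    (h : ∀ (K : Type) [Group K] [Finite K], ∃ f : K →* G, Function.Injective f) :
    IsHallUniversalGroup (ConjugatorLimit G) where
  countable := inferInstance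
  locallyFinite := isLocallyFiniteGroup hG
  embeds_finite K _ _ := by
    obtain ⟨f, hf⟩ := h K
    exact ⟨(of G 0).comp f, (of_injective G 0).comp hf⟩
  conj_of_iso := by
    rintro A B hA hB ⟨θ⟩
    obtain ⟨t, ht⟩ := exists_conj_eq hG A.subtype (B.subtype.comp θ.toMonoidHom)
      A.subtype_injective (B.subtype_injective.comp θ.injective)
    refine ⟨t, le_antisymm ?_ fun b hb => ?_⟩
    · rintro _ ⟨a, ha, rfl⟩
      exact (congrArg (· ∈ B) (ht ⟨a, ha⟩)).mpr (θ ⟨a, ha⟩).2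
    · refine ⟨θ.symm ⟨b, hb⟩, SetLike.coe_mem _, (ht _).trans ?_⟩
      simp

/-- The action of a single automorphism of `G` on the limit, as a function. -/
def autMap (σ : MulAut G) : ConjugatorLimit G → ConjugatorLimit G :=
  DirectLimit.map _ _ (fun n => autHom G n σ) fun _ _ h x => (autHom_transition G σ h x).symm

theorem autMap_of (σ : MulAut G) (n : ℕ) (x : conjugatorTower G n) :
    autMap G σ (of G n x) = of G n (autHom G n σ x) := rfl

theorem autMap_mul (σ τ : MulAut G) (z : ConjugatorLimit G) :
    autMap G (σ * τ) z = autMap G σ (autMap G τ z) := by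
  obtain ⟨n, x, rfl⟩ := exists_mem_range_of G z
  simp [autMap_of]

theorem autMap_one (z : ConjugatorLimit G) : autMap G 1 z = z := by
  obtain ⟨n, x, rfl⟩ := exists_mem_range_of G z
  simp [autMap_of]

theorem autMap_map_mul (σ : MulAut G) (z w : ConjugatorLimit G) :
    autMap G σ (z * w) = autMap G σ z * autMap G σ w := by
  obtain ⟨n, x, y, rfl, rfl⟩ := DirectLimit.exists_eq_mk₂ (transition G) z w
  change autMap G σ (of G n x * of G n y) = autMap G σ (of G n x) * autMap G σ (of G n y)
  simp only [← map_mul, autMap_of]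

/-- The canonical extension of the automorphisms of `G` to the limit. -/
def autHom : MulAut G →* MulAut (ConjugatorLimit G) where
  toFun σ :=
    { toFun := autMap G σ
      invFun := autMap G σ⁻¹
      left_inv := fun z => by rw [← autMap_mul, inv_mul_cancel, autMap_one]
      right_inv := fun z => by rw [← autMap_mul, mul_inv_cancel, autMap_one]
      map_mul' := autMap_map_mul G σ }
  map_one' := MulEquiv.ext (autMap_one G)
  map_mul' σ τ := MulEquiv.ext (autMap_mul G σ τ)

theorem autHom_of (σ : MulAut G) (x : G) : autHom G σ (of G 0 x) = of G 0 (σ x) := rfl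

end ConjugatorLimit

end Tower

/-! ### Transport to `H`. -/

/-- Automorphisms of a direct factor extend canonically to the product. -/
def MulAut.prodLeft (G H : Type*) [Group G] [Group H] : MulAut G →* MulAut (G × H) where
  toFun σ := MulEquiv.prodCongr σ (MulEquiv.refl H)
  map_one' := rfl
  map_mul' _ _ := rfl

theorem theorem4 {H : Type*} [Group H] (hH : IsHallUniversalGroup H)
    {G : Type*} [Group G] [Countable G] (hG : IsLocallyFiniteGroup G) :
    ∃ G' : Subgroup H, Nonempty (G ≃* G') ∧
      ∃ F : MulAut G' →* MulAut H, Function.Injective F ∧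
        ∀ (f : MulAut G') (x : G'), F f (x : H) = (f x : H) := by
  have := hH.countable
  have hL : IsHallUniversalGroup (ConjugatorLimit (G × H)) :=
    ConjugatorLimit.isHallUniversalGroup (hG.prod hH.locallyFinite) fun K _ _ => by
      obtain ⟨f, hf⟩ := hH.embeds_finite K
      exact ⟨(MonoidHom.inr G H).comp f, (Prod.mk_right_injective 1).comp hf⟩
  obtain ⟨e⟩ := hL.nonempty_mulEquiv hH
  let ι : G →* H :=
    e.toMonoidHom.comp ((ConjugatorLimit.of (G × H) 0).comp (MonoidHom.inl G H))
  have hι : Function.Injective ι := e.injective.comp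
    ((ConjugatorLimit.of_injective (G × H) 0).comp (Prod.mk_left_injective 1))
  let φ : G ≃* ι.range := MonoidHom.ofInjective hι
  let F : MulAut ι.range →* MulAut H := (MulAut.congr e).toMonoidHom.comp
    ((ConjugatorLimit.autHom (G × H)).comp
      ((MulAut.prodLeft G H).comp (MulAut.congr φ.symm).toMonoidHom))
  have hF : ∀ (f : MulAut ι.range) (x : ι.range), F f (x : H) = (f x : H) := by
    intro f x
    obtain ⟨g, rfl⟩ := φ.surjective x
    have h1 : F f (φ g : H) = e (ConjugatorLimit.autHom (G × H)
        (MulAut.prodLeft G H (MulAut.congr φ.symm f))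
        (e.symm (e (ConjugatorLimit.of (G × H) 0 (g, 1))))) := rfl
    rw [h1, e.symm_apply_apply, ConjugatorLimit.autHom_of]
    have h2 : MulAut.prodLeft G H (MulAut.congr φ.symm f) (g, 1) = (φ.symm (f (φ g)), 1) := rfl
    rw [h2]
    exact congrArg Subtype.val (φ.apply_symm_apply (f (φ g)))
  -- Injectivity is automatic, since `f` is recovered by restricting `F f`.
  refine ⟨ι.range, ⟨φ⟩, F, fun f f' hff' => ?_, hF⟩
  ext x
  rw [← hF, ← hF, hff']
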